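/- Let $\Omega$ be a finite set and let $G\le\operatorname{Sym}(\Omega)$ be a solvable permutation group. Then $G$ admits an asymmetric $5$-coloring: there is a function $\gamma:\Omega\to\{1,2,3,4,5\}$ (not necessarily surjective) such that the identity is the only $\pi\in G$ with $\gamma(\pi^{-1}(x))=\gamma(x)$ for all $x\in\Omega$. -/

import Mathlib

namespace PermGroupColoring

variable {Ω C : Type*}

/-- The image `π(γ)` of a coloring `γ : Ω → C` under a permutation `π` of `Ω`:
`(π(γ))(x) = γ(π⁻¹(x))`. -/
def permute (π : Equiv.Perm Ω) (γ : Ω → C) : Ω → C :=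
  fun x => γ (π⁻¹ x)

/-- The stabilizer `G_γ = {π ∈ G | π(γ) = γ}` of a coloring `γ` in a permutation group
`G ≤ Sym(Ω)`, as a subgroup of `Sym(Ω)`. -/
def colorStabilizer (G : Subgroup (Equiv.Perm Ω)) (γ : Ω → C) : Subgroup (Equiv.Perm Ω) where
  carrier := {π | π ∈ G ∧ permute π γ = γ}
  one_mem' := ⟨G.one_mem, rfl⟩
  mul_mem' := by
    rintro π ρ ⟨hπ, hπγ⟩ ⟨hρ, hργ⟩
    refine ⟨G.mul_mem hπ hρ, ?_⟩
    calc permute (π * ρ) γ = permute π (permute ρ γ) := by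
          funext x
          simp [permute, mul_inv_rev]
      _ = γ := by rw [hργ, hπγ]
  inv_mem' := by
    rintro π ⟨hπ, hπγ⟩
    refine ⟨G.inv_mem hπ, ?_⟩
    funext x
    have h := congrFun hπγ (π x)
    simpa [permute] using h.symm

/-- A coloring `γ` is asymmetric for `G` if `G_γ = 1`. -/
def IsAsymmetric (G : Subgroup (Equiv.Perm Ω)) (γ : Ω → C) : Prop :=
  colorStabilizer G γ = ⊥

/-- `G` admits an asymmetric `k`-coloring: some map from `Ω` to a fixed set of `k` colors
(not all of which have to be used) is asymmetric for `G`. -/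
def AdmitsAsymmetricColoring (G : Subgroup (Equiv.Perm Ω)) (k : ℕ) : Prop :=
  ∃ γ : Ω → Fin k, IsAsymmetric G γ

end PermGroupColoring

/-!
The colors are taken in `ZMod 5`, and a stronger property is proved by induction on the number of
points, for every action of a solvable group on a nonempty finite set `X`: some coloring
`γ : X → ZMod 5` is *shift-asymmetric*, meaning that `γ (g • x) = γ x + c` for all `x` is possible
only if `c = 0` and `g` acts trivially. For a faithful action this says that the five cyclic shifts
of `γ` are asymmetric and pairwise inequivalent, and this is what makes the induction close up.

* If the action is intransitive, shift-asymmetric colorings of the orbits are put together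
  (`exists_isShiftAsymmetric_of_orbits`).
* If there is a nontrivial block `B`, copy a shift-asymmetric coloring of `B` to every translate of
  `B`, and shift each copy by the color that its translate has in a shift-asymmetric coloring of the
  block system (`exists_isShiftAsymmetric_of_isBlock`).
* If the action is primitive, solvability makes it affine: `X` is a vector space over `ZMod p` on
  which the stabilizer of the origin acts linearly (`exists_isShiftAsymmetric_of_faithful`). For a
  basis `e 0, …, e n`, give one color each to the origin, to `e 0`, to the other basis vectors, to
  the sums `e i + e (i + 1)`, and to the remaining vectors. A linear map preserving the classes
  fixes the path `e 0, …, e n` pointwise (`eq_id_of_basisColoring_preserved`). A nonzero shift would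
  force all classes to be singletons, so that `X` would have five elements and dimension at least
  two, which is absurd (`shift_eq_zero_of_basisColoring`).
-/

open scoped Pointwise

namespace PermGroupColoring

/-! ### A rigid coloring of a vector space -/

section AffineSpace

variable {p : ℕ} [Fact p.Prime] {V : Type*} [AddCommGroup V] [Module (ZMod p) V] {n : ℕ}

open Classical in
/-- The coloring of a vector space with basis `e 0, …, e n` that gives the origin, the vector `e 0`,
the other basis vectors, the sums `e i + e (i + 1)`, and all remaining vectors five different
colors. -/
noncomputable def basisColoring (e : Module.Basis (Fin (n + 1)) (ZMod p) V) (v : V) : ZMod 5 :=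
  if v = 0 then 1
  else if v = e 0 then 4
  else if ∃ k, v = e k then 2
  else if ∃ i j : Fin (n + 1), j.val = i.val + 1 ∧ v = e i + e j then 3
  else 0

theorem exists_basis_fin_succ [Finite V] [Nontrivial V] :
    ∃ n : ℕ, Nonempty (Module.Basis (Fin (n + 1)) (ZMod p) V) := by
  have hpos : 0 < Module.finrank (ZMod p) V := Module.finrank_pos
  obtain ⟨n, hn⟩ := Nat.exists_eq_succ_of_ne_zero hpos.ne'
  exact ⟨n, ⟨Module.finBasisOfFinrankEq (ZMod p) V hn⟩⟩

variable (e : Module.Basis (Fin (n + 1)) (ZMod p) V)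

theorem basis_add_basis_ne_zero {i j : Fin (n + 1)} (hij : i ≠ j) : e i + e j ≠ 0 := by
  intro h
  have := congrArg (fun v => e.repr v i) h
  simp [hij] at this

theorem basis_add_basis_ne_basis {i j : Fin (n + 1)} (hij : i ≠ j) (k : Fin (n + 1)) :
    e i + e j ≠ e k := by
  intro h
  have h1 := congrArg (fun v => e.repr v i) h
  have h2 := congrArg (fun v => e.repr v j) h
  simp only [map_add, Module.Basis.repr_self, Finsupp.add_apply, Finsupp.single_apply,
    if_neg hij, if_neg hij.symm, if_true, add_zero, zero_add] at h1 h2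
  by_cases hki : k = i
  · rw [if_neg (fun h => hij (hki.symm.trans h))] at h2
    exact one_ne_zero h2
  · rw [if_neg hki] at h1
    exact one_ne_zero h1

theorem basis_add_basis_inj {i j k l : Fin (n + 1)} (hij : i ≠ j) (h : e i + e j = e k + e l) :
    i = k ∧ j = l ∨ i = l ∧ j = k := by
  have h1 := congrArg e.repr h
  simp only [map_add, Module.Basis.repr_self] at h1
  rcases (Finsupp.single_add_single_eq_single_add_single one_ne_zero one_ne_zero).1 h1 with
    h | h | h
  · exact Or.inl h
  · exact Or.inr h.2
  · exact absurd h.2.1 hij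

theorem eq_zero_of_basisColoring {v : V} (h : basisColoring e v = 1) : v = 0 := by
  unfold basisColoring at h
  split_ifs at h with h1
  · exact h1
  all_goals exact absurd h (by decide)

theorem eq_basis_zero_of_basisColoring {v : V} (h : basisColoring e v = 4) : v = e 0 := by
  unfold basisColoring at h
  split_ifs at h with h1 h2
  all_goals first | exact h2 | exact absurd h (by decide)

theorem exists_basis_of_basisColoring {v : V} (h : basisColoring e v = 2) : ∃ k, v = e k := by
  unfold basisColoring at h
  split_ifs at h with h1 h2 h3
  all_goals first | exact h3 | exact absurd h (by decide)

theorem exists_add_of_basisColoring {v : V} (h : basisColoring e v = 3) :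
    ∃ i j : Fin (n + 1), j.val = i.val + 1 ∧ v = e i + e j := by
  unfold basisColoring at h
  split_ifs at h with h1 h2 h3 h4
  all_goals first | exact h4 | exact absurd h (by decide)

theorem basisColoring_zero : basisColoring e 0 = 1 := by
  simp [basisColoring]

theorem basisColoring_basis_zero : basisColoring e (e 0) = 4 := by
  rw [basisColoring, if_neg (e.ne_zero 0), if_pos rfl]

theorem basisColoring_basis {k : Fin (n + 1)} (hk : k ≠ 0) : basisColoring e (e k) = 2 := by
  rw [basisColoring, if_neg (e.ne_zero k), if_neg (fun h => hk (e.injective h)), if_pos ⟨k, rfl⟩]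

theorem basisColoring_add {i j : Fin (n + 1)} (hij : j.val = i.val + 1) :
    basisColoring e (e i + e j) = 3 := by
  have hne : i ≠ j := by
    rintro rfl
    omega
  rw [basisColoring, if_neg (basis_add_basis_ne_zero e hne),
    if_neg (basis_add_basis_ne_basis e hne 0),
    if_neg (fun ⟨k, hk⟩ => basis_add_basis_ne_basis e hne k hk), if_pos ⟨i, j, hij, rfl⟩]

/-- An injective additive map that preserves the colors is the identity: it fixes `e 0`, permutes
the remaining basis vectors, and the sums `e i + e (i + 1)` force it to fix the path
`e 0, e 1, …, e n` vertex by vertex. -/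
theorem eq_id_of_basisColoring_preserved (f : V →+ V) (hinj : Function.Injective f)
    (hf : ∀ v, basisColoring e (f v) = basisColoring e v) (v : V) : f v = v := by
  have key : ∀ m : ℕ, ∀ k : Fin (n + 1), k.val = m → f (e k) = e k := by
    intro m
    induction m using Nat.strong_induction_on with
    | _ m ih =>
      rintro k rfl
      by_cases hk : k = 0
      · subst hk
        exact eq_basis_zero_of_basisColoring e ((hf _).trans (basisColoring_basis_zero e))
      · obtain ⟨j, hj⟩ := exists_basis_of_basisColoring e ((hf _).trans (basisColoring_basis e hk))
        have hkpos : k.val ≠ 0 := fun h => hk (Fin.ext h)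
        let l : Fin (n + 1) := ⟨k.val - 1, by omega⟩
        have hl : k.val = l.val + 1 := by
          change k.val = k.val - 1 + 1
          omega
        have hfl : f (e l) = e l := ih l.val (by omega) l rfl
        have hlj : l ≠ j := by
          intro h
          have : k = l := e.injective (hinj (by rw [hj, hfl, h]))
          rw [← this] at hl
          omega
        obtain ⟨a, b, hab, h⟩ :=
          exists_add_of_basisColoring e ((hf _).trans (basisColoring_add e hl))
        rw [map_add, hfl, hj] at h
        rcases basis_add_basis_inj e hlj h with ⟨rfl, rfl⟩ | ⟨rfl, rfl⟩
        · rw [hj, Fin.ext (hab.trans hl.symm)]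
        -- In this case `f (e k)` would be the basis vector two steps before `e k`, already fixed.
        · have hfj : f (e j) = e j := ih j.val (by omega) j rfl
          have : k = j := e.injective (hinj (by rw [hj, hfj]))
          rw [← this] at hab
          omega
  have hlin : f.toZModLinearMap p = LinearMap.id := e.ext fun k => key _ k rfl
  exact LinearMap.congr_fun hlin v

/-- A bijection of `V` that shifts the colors by a constant does not shift them at all. Otherwise
all five color classes would be equinumerous, hence singletons like the class of `0`, so that
`V` would have five elements and dimension at least two. -/
theorem shift_eq_zero_of_basisColoring (f : V ≃ V) (c : ZMod 5)
    (hf : ∀ v, basisColoring e (f v) = basisColoring e v + c) : c = 0 := by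
  have : Fact (Nat.Prime 5) := ⟨by norm_num⟩
  by_contra hc
  have hiter : ∀ (k : ℕ) (v : V), basisColoring e (f^[k] v) = basisColoring e v + k * c := by
    intro k
    induction k with
    | zero => simp
    | succ k ih =>
      intro v
      rw [Function.iterate_succ_apply', hf, ih]
      push_cast
      ring
  have hreach : ∀ a b : ZMod 5, ∃ k : ℕ, a + k * c = b := by
    intro a b
    refine ⟨((b - a) * c⁻¹).val, ?_⟩
    rw [ZMod.natCast_zmod_val, mul_assoc, inv_mul_cancel₀ hc]
    ring
  have hbij : Function.Bijective (basisColoring e) := by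
    constructor
    · intro v w hvw
      obtain ⟨k, hk⟩ := hreach (basisColoring e v) 1
      have hv := eq_zero_of_basisColoring e ((hiter k v).trans hk)
      have hw := eq_zero_of_basisColoring e ((hiter k w).trans (hvw ▸ hk))
      exact f.injective.iterate k (hv.trans hw.symm)
    · intro b
      obtain ⟨k, hk⟩ := hreach (basisColoring e 0) b
      exact ⟨_, (hiter k 0).trans hk⟩
  obtain ⟨v, hv⟩ := hbij.2 3
  obtain ⟨i, j, hij, -⟩ := exists_add_of_basisColoring e hv
  have hcard : Nat.card V = 5 := by
    rw [Nat.card_eq_of_bijective _ hbij, Nat.card_zmod]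
  rw [Nat.card_congr e.equivFun.toEquiv, Nat.card_fun, Nat.card_zmod, Nat.card_fin] at hcard
  have hp : (p ^ (n + 1)).Prime := hcard ▸ (by norm_num)
  have := hp.eq_one_of_pow
  omega

end AffineSpace

/-- A coloring by `ZMod 5` is shift-asymmetric for an action of `G` if no pair `(g, c)` shifts the
colors by `c` along `g`, unless `c = 0` and `g` acts trivially. -/
def IsShiftAsymmetric (G : Type*) {X : Type*} [Group G] [MulAction G X] (γ : X → ZMod 5) : Prop :=
  ∀ (g : G) (c : ZMod 5), (∀ x, γ (g • x) = γ x + c) → c = 0 ∧ ∀ x : X, g • x = x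

/-! ### Combining colorings of orbits and of blocks -/

section Combination
variable {G : Type*} [Group G] {X : Type*} [MulAction G X]

/-- Shift-asymmetric colorings of the orbits combine to one of the whole set. -/
theorem exists_isShiftAsymmetric_of_orbits [Nonempty X]
    (h : ∀ a : X, ∃ γ : MulAction.orbit G a → ZMod 5, IsShiftAsymmetric G γ) :
    ∃ γ : X → ZMod 5, IsShiftAsymmetric G γ := by
  have h' : ∀ ω : MulAction.orbitRel.Quotient G X,
      ∃ γ : ω.orbit → ZMod 5, IsShiftAsymmetric G γ := by
    intro ω
    induction ω using Quotient.inductionOn' with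
    | h a => exact h a
  choose col hcol using h'
  let γ : X → ZMod 5 := fun x =>
    col (Quotient.mk'' x) ⟨x, MulAction.orbitRel.Quotient.mem_orbit.2 rfl⟩
  have hγ : ∀ (ω : MulAction.orbitRel.Quotient G X) (y : ω.orbit), γ y = col ω y := by
    rintro ω ⟨y, hy⟩
    obtain rfl := MulAction.orbitRel.Quotient.mem_orbit.1 hy
    rfl
  refine ⟨γ, fun g c hg => ?_⟩
  have key : ∀ ω : MulAction.orbitRel.Quotient G X, c = 0 ∧ ∀ y : ω.orbit, g • y = y := by
    intro ω
    refine hcol ω g c fun y => ?_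
    rw [← hγ, ← hγ, ← hg]
    rfl
  refine ⟨(key (Quotient.mk'' (Classical.arbitrary X))).1, fun x => ?_⟩
  have hx := (key (Quotient.mk'' x)).2 ⟨x, MulAction.orbitRel.Quotient.mem_orbit.2 rfl⟩
  exact congrArg Subtype.val hx

/-- Shift-asymmetric colorings of a block `B` and of the system of its translates combine: choose
`t b : G` carrying `B` onto each translate `b`, and give `x ∈ b` the sum of the color of
`(t b)⁻¹ • x` in `B` and the color of `b`. -/
theorem exists_isShiftAsymmetric_of_isBlock [MulAction.IsPretransitive G X] {B : Set X}
    (hB : MulAction.IsBlock G B) (hne : B.Nonempty)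
    (h₁ : ∃ γ : B → ZMod 5, IsShiftAsymmetric (MulAction.stabilizer G B) γ)
    (h₂ : ∃ γ : MulAction.orbit G B → ZMod 5, IsShiftAsymmetric G γ) :
    ∃ γ : X → ZMod 5, IsShiftAsymmetric G γ := by
  obtain ⟨α, hα⟩ := h₁
  obtain ⟨β, hβ⟩ := h₂
  have htr : ∀ b : MulAction.orbit G B, ∃ t : G, t • B = b.1 := fun b => b.2
  choose t ht using htr
  have hcover : ∀ x : X, ∃ b : MulAction.orbit G B, x ∈ b.1 := by
    intro x
    obtain ⟨y, hy⟩ := hne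
    obtain ⟨g, rfl⟩ := MulAction.exists_smul_eq G y x
    exact ⟨⟨g • B, MulAction.mem_orbit _ _⟩, Set.smul_mem_smul_set hy⟩
  choose blk hblk using hcover
  have huniq : ∀ (x : X) (b : MulAction.orbit G B), x ∈ b.1 → blk x = b := by
    intro x b hx
    refine Subtype.ext ?_
    rw [← ht, ← ht b]
    refine MulAction.isBlock_iff_smul_eq_smul_of_nonempty.1 hB ⟨x, ?_, ?_⟩
    · rw [ht]
      exact hblk x
    · rwa [ht]
  have hmem : ∀ x, (t (blk x))⁻¹ • x ∈ B := by
    intro x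
    rw [← Set.mem_smul_set_iff_inv_smul_mem, ht]
    exact hblk x
  let γ : X → ZMod 5 := fun x => α ⟨(t (blk x))⁻¹ • x, hmem x⟩ + β (blk x)
  have hγ : ∀ (b : MulAction.orbit G B) (y : B), γ (t b • y.1) = α y + β b := by
    intro b y
    have hb : blk (t b • y.1) = b := huniq _ _ (by
      rw [← ht b]
      exact Set.smul_mem_smul_set y.2)
    have hy : (⟨(t (blk (t b • y.1)))⁻¹ • t b • y.1, hmem _⟩ : B) = y := by
      refine Subtype.ext ?_
      change (t (blk (t b • y.1)))⁻¹ • t b • y.1 = y.1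
      rw [hb, inv_smul_smul]
    change α _ + β _ = _
    rw [hy, hb]
  refine ⟨γ, fun g c hg => ?_⟩
  have hstab : ∀ b : MulAction.orbit G B,
      (t (g • b))⁻¹ * g * t b ∈ MulAction.stabilizer G B := by
    intro b
    rw [MulAction.mem_stabilizer_iff, mul_smul, mul_smul, ht, inv_smul_eq_iff, ht]
    rfl
  -- For each translate `b`, the map induced by `g` from `b` to `g • b`, read in `B`, shifts `α`.
  have key : ∀ b : MulAction.orbit G B, β b + c - β (g • b) = 0 ∧
      ∀ y : B, (⟨_, hstab b⟩ : MulAction.stabilizer G B) • y = y := by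
    intro b
    refine hα ⟨_, hstab b⟩ _ fun y => ?_
    have h1 := hγ (g • b) ((⟨_, hstab b⟩ : MulAction.stabilizer G B) • y)
    have h2 : t (g • b) • ((⟨_, hstab b⟩ : MulAction.stabilizer G B) • y : B).1
        = g • t b • y.1 := by
      rw [SMul.smul_stabilizer_def]
      change t (g • b) • (((t (g • b))⁻¹ * g * t b) • y.1) = _
      simp [mul_smul]
    rw [h2, hg, hγ] at h1
    rw [eq_sub_of_add_eq h1.symm]
    ring
  obtain ⟨hc, hfix⟩ := hβ g c fun b => (sub_eq_zero.1 (key b).1).symm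
  refine ⟨hc, fun x => ?_⟩
  have hx := congrArg Subtype.val ((key (blk x)).2 ⟨_, hmem x⟩)
  rw [SMul.smul_stabilizer_def] at hx
  change ((t (g • blk x))⁻¹ * g * t (blk x)) • ((t (blk x))⁻¹ • x) = (t (blk x))⁻¹ • x at hx
  rw [hfix] at hx
  simpa [mul_smul] using hx

end Combination

/-! ### Primitive actions -/

section Primitive

/-- A nontrivial finite solvable group has a nontrivial normal elementary abelian subgroup: the
elements of order dividing `p` in the last nontrivial term of the derived series. -/
theorem exists_normal_elementaryAbelian (G : Type*) [Group G] [Finite G] [Nontrivial G]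
    [Group.IsSolvable G] :
    ∃ (p : ℕ) (N : Subgroup G), p.Prime ∧ N.Normal ∧ N ≠ ⊥ ∧
      (∀ a ∈ N, ∀ b ∈ N, a * b = b * a) ∧ ∀ a ∈ N, a ^ p = 1 := by
  classical
  have hex : ∃ n, derivedSeries G n = ⊥ := Group.IsSolvable.solvable
  obtain ⟨n, hn⟩ : ∃ n, Nat.find hex = n + 1 := by
    refine Nat.exists_eq_succ_of_ne_zero fun h0 => ?_
    have h := Nat.find_spec hex
    rw [h0, derivedSeries_zero] at h
    exact top_ne_bot h
  have hA : derivedSeries G n ≠ ⊥ := Nat.find_min hex (by omega)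
  have hcomm : ∀ a ∈ derivedSeries G n, ∀ b ∈ derivedSeries G n, a * b = b * a := by
    intro a ha b hb
    have h := Nat.find_spec hex
    rw [hn, derivedSeries_succ, Subgroup.commutator_eq_bot_iff_le_centralizer] at h
    exact Subgroup.mem_centralizer_iff.1 (h hb) a ha
  have hnormal : (derivedSeries G n).Normal := derivedSeries_normal G n
  have hcard : Nat.card (derivedSeries G n) ≠ 1 := fun h => hA (Subgroup.card_eq_one.1 h)
  obtain ⟨p, hp, hpd⟩ := Nat.exists_prime_and_dvd hcard
  have : Fact p.Prime := ⟨hp⟩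
  obtain ⟨z, hz⟩ := exists_prime_orderOf_dvd_card' p hpd
  let N : Subgroup G :=
    { carrier := {a | a ∈ derivedSeries G n ∧ a ^ p = 1}
      one_mem' := ⟨one_mem _, one_pow p⟩
      mul_mem' := by
        rintro a b ⟨ha, ha'⟩ ⟨hb, hb'⟩
        exact ⟨mul_mem ha hb, by rw [Commute.mul_pow (hcomm a ha b hb), ha', hb', one_mul]⟩
      inv_mem' := by
        rintro a ⟨ha, ha'⟩
        exact ⟨inv_mem ha, by rw [inv_pow, ha', inv_one]⟩ }
  refine ⟨p, N, hp, ⟨?_⟩, ?_, fun a ha b hb => hcomm a ha.1 b hb.1, fun a ha => ha.2⟩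
  · rintro a ⟨ha, ha'⟩ g
    exact ⟨hnormal.conj_mem a ha g, by rw [conj_pow, ha', mul_one, mul_inv_cancel]⟩
  · intro hbot
    have hzN : (z : G) ∈ N := ⟨z.2, by rw [← Subgroup.coe_pow, ← hz, pow_orderOf_eq_one]; rfl⟩
    rw [hbot, Subgroup.mem_bot, OneMemClass.coe_eq_one, ← orderOf_eq_one_iff, hz] at hzN
    exact hp.one_lt.ne' hzN

/-- A faithful primitive action of a finite solvable group is affine: a normal elementary abelian
subgroup `N` acts regularly, so that the set is a vector space over `ZMod p` on which the
stabilizer of the origin acts by conjugation on `N`, hence linearly. -/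
theorem exists_isShiftAsymmetric_of_faithful {G : Type*} [Group G] [Finite G] [Group.IsSolvable G]
    {X : Type*} [MulAction G X] [Nontrivial X] [FaithfulSMul G X]
    [MulAction.IsPreprimitive G X] : ∃ γ : X → ZMod 5, IsShiftAsymmetric G γ := by
  have : Nontrivial G := by
    obtain ⟨x, y, hxy⟩ := exists_pair_ne X
    obtain ⟨g, hg⟩ := MulAction.exists_smul_eq G x y
    refine ⟨g, 1, ?_⟩
    rintro rfl
    exact hxy (by rwa [one_smul] at hg)
  obtain ⟨p, N, hp, hN, hNbot, hcomm, hpow⟩ := exists_normal_elementaryAbelian G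
  have : Fact p.Prime := ⟨hp⟩
  have htrans : MulAction.IsPretransitive N X := by
    refine MulAction.IsQuasiPreprimitive.isPretransitive_of_normal fun h => hNbot ?_
    rw [Subgroup.eq_bot_iff_forall]
    intro a ha
    refine FaithfulSMul.eq_of_smul_eq_smul (α := X) fun x => ?_
    have hx : x ∈ MulAction.fixedPoints N X := h ▸ Set.mem_univ x
    rw [one_smul]
    exact hx ⟨a, ha⟩
  let x₀ : X := Classical.arbitrary X
  let : CommGroup N := { mul_comm := fun a b => Subtype.ext (hcomm a a.2 b b.2) }
  let : Module (ZMod p) (Additive N) := AddCommGroup.zmodModule fun a => by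
    refine Additive.toMul.injective (Subtype.ext ?_)
    exact hpow _ (Additive.toMul a).2
  have hbij : Function.Bijective fun a : Additive N => ((Additive.toMul a : N) : G) • x₀ := by
    constructor
    · intro a b hab
      refine Additive.toMul.injective (Subtype.ext ?_)
      refine FaithfulSMul.eq_of_smul_eq_smul (α := X) fun x => ?_
      obtain ⟨c, rfl⟩ := MulAction.exists_smul_eq N x₀ x
      change (_ : G) • (c : G) • x₀ = (_ : G) • (c : G) • x₀
      rw [← mul_smul, ← mul_smul, hcomm _ (SetLike.coe_mem _) _ c.2,
        hcomm _ (SetLike.coe_mem _) _ c.2, mul_smul, mul_smul]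
      exact congrArg _ hab
    · intro x
      obtain ⟨c, hc⟩ := MulAction.exists_smul_eq N x₀ x
      exact ⟨Additive.ofMul c, hc⟩
  let e : Additive N ≃ X := Equiv.ofBijective _ hbij
  have he : ∀ a : Additive N, e a = ((Additive.toMul a : N) : G) • x₀ := fun a => rfl
  have he0 : e 0 = x₀ := by
    rw [he]
    exact one_smul G x₀
  have : Nontrivial (Additive N) := e.nontrivial
  have : Finite (Additive N) := Finite.of_equiv N Additive.ofMul
  obtain ⟨n, ⟨b⟩⟩ := exists_basis_fin_succ (p := p) (V := Additive N)
  refine ⟨fun x => basisColoring b (e.symm x), fun g c hg => ?_⟩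
  let f : Additive N ≃ Additive N := (e.trans (MulAction.toPerm g)).trans e.symm
  have hef : ∀ a, e (f a) = g • e a := fun a => e.apply_symm_apply _
  have hshift : ∀ a, basisColoring b (f a) = basisColoring b a + c := by
    intro a
    have h := hg (e a)
    rw [← hef] at h
    simpa only [e.symm_apply_apply] using h
  have hc : c = 0 := shift_eq_zero_of_basisColoring b f c hshift
  refine ⟨hc, ?_⟩
  have hpres : ∀ a, basisColoring b (f a) = basisColoring b a := by
    intro a
    rw [hshift, hc, add_zero]
  have hf0 : f 0 = 0 := eq_zero_of_basisColoring b ((hpres 0).trans (basisColoring_zero b))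
  have hgx₀ : g • x₀ = x₀ := by rw [← he0, ← hef, hf0]
  have hconj : ∀ a, f a =
      Additive.ofMul
        (⟨g * (Additive.toMul a : N) * g⁻¹, hN.conj_mem _ (SetLike.coe_mem _) g⟩ : N) := by
    intro a
    refine e.injective ?_
    rw [hef, he, he]
    change _ = (g * _ * g⁻¹) • x₀
    rw [mul_smul, mul_smul, inv_smul_eq_iff.2 hgx₀.symm]
  let F : Additive N →+ Additive N :=
    { toFun := f
      map_zero' := hf0
      map_add' := fun u v => by
        rw [hconj, hconj, hconj]
        refine Additive.toMul.injective (Subtype.ext ?_)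
        change g * ((_ : G) * (_ : G)) * g⁻¹ = (g * _ * g⁻¹) * (g * _ * g⁻¹)
        group }
  intro x
  have hx := hef (e.symm x)
  rwa [show f (e.symm x) = e.symm x from
    eq_id_of_basisColoring_preserved b F f.injective hpres _, e.apply_symm_apply, eq_comm] at hx

theorem exists_isShiftAsymmetric_of_isPreprimitive {G : Type*} [Group G] [Group.IsSolvable G]
    {X : Type*} [MulAction G X] [Finite X] [Nontrivial X] [MulAction.IsPreprimitive G X] :
    ∃ γ : X → ZMod 5, IsShiftAsymmetric G γ := by
  let φ : G →* (MulAction.toPermHom G X).range := (MulAction.toPermHom G X).rangeRestrict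
  have hφ : Function.Surjective φ := (MulAction.toPermHom G X).rangeRestrict_surjective
  have : Group.IsSolvable (MulAction.toPermHom G X).range := Group.isSolvable_of_surjective hφ
  let f : X →ₑ[φ] X := { toFun := id, map_smul' := fun _ _ => rfl }
  have : MulAction.IsPreprimitive (MulAction.toPermHom G X).range X :=
    MulAction.IsPreprimitive.of_surjective (f := f) Function.surjective_id
  obtain ⟨γ, hγ⟩ := exists_isShiftAsymmetric_of_faithful
    (G := (MulAction.toPermHom G X).range) (X := X)
  exact ⟨γ, fun g c hg => hγ (φ g) c hg⟩

end Primitive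

/-! ### Induction on the number of points -/

/-- Induction on the number of points: an intransitive action is split into its orbits, an
imprimitive one into a block and the system of its translates. -/
theorem exists_isShiftAsymmetric (G : Type*) [Group G] [Group.IsSolvable G] (X : Type*)
    [MulAction G X] [Finite X] [Nonempty X] : ∃ γ : X → ZMod 5, IsShiftAsymmetric G γ := by
  induction hn : Nat.card X using Nat.strong_induction_on generalizing G X with
  | _ n ih =>
    subst hn
    by_cases htr : MulAction.IsPretransitive G X
    · rcases subsingleton_or_nontrivial X with hX | hX
      · refine ⟨fun _ => 0, fun g c hg => ⟨?_, fun x => Subsingleton.elim _ _⟩⟩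
        simpa using (hg (Classical.arbitrary X)).symm
      by_cases hprim : MulAction.IsPreprimitive G X
      · exact exists_isShiftAsymmetric_of_isPreprimitive
      obtain ⟨B, hB, hBt⟩ : ∃ B : Set X, MulAction.IsBlock G B ∧ ¬ MulAction.IsTrivialBlock B := by
        by_contra! h
        exact hprim { isTrivialBlock_of_isBlock := fun {B} hB => h B hB }
      obtain ⟨hBs, hBu⟩ := not_or.1 hBt
      have hBn : B.Nontrivial := Set.not_subsingleton_iff.1 hBs
      have : Nonempty B := hBn.nonempty.to_subtype
      have : Nonempty (MulAction.orbit G B) := ⟨⟨B, MulAction.mem_orbit_self B⟩⟩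
      have hmul := hB.ncard_block_mul_ncard_orbit_eq hBn.nonempty
      have hB1 : 1 < B.ncard := Set.one_lt_ncard_iff_nontrivial.2 hBn
      have hBX : B.ncard < Nat.card X := Set.ncard_lt_card hBu
      refine exists_isShiftAsymmetric_of_isBlock hB hBn.nonempty
        (ih _ hBX _ _ rfl) (ih _ ?_ _ _ rfl)
      change (MulAction.orbit G B).ncard < _
      nlinarith
    · refine exists_isShiftAsymmetric_of_orbits fun a => ?_
      have : Nonempty (MulAction.orbit G a) := ⟨⟨a, MulAction.mem_orbit_self a⟩⟩
      refine ih _ ?_ _ _ rfl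
      refine Set.ncard_lt_card fun h => htr ?_
      exact (MulAction.isPretransitive_iff_orbit_eq_univ a).2 h

end PermGroupColoring

theorem mainTheorem6 {Ω : Type*} [Finite Ω] (G : Subgroup (Equiv.Perm Ω))
    (hG : Group.IsSolvable G) : PermGroupColoring.AdmitsAsymmetricColoring G 5 := by
  rcases isEmpty_or_nonempty Ω with hΩ | hΩ
  · exact ⟨fun _ => 0, Subsingleton.elim _ _⟩
  obtain ⟨γ, hγ⟩ := PermGroupColoring.exists_isShiftAsymmetric G Ω
  -- `ZMod 5` is `Fin 5` by definition.
  refine ⟨γ, (Subgroup.eq_bot_iff_forall _).2 ?_⟩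
  rintro π ⟨hπ, hπγ⟩
  refine Equiv.ext fun x => (hγ ⟨π, hπ⟩ 0 fun y => ?_).2 x
  have h := congrFun hπγ (π y)
  have hy : π⁻¹ (π y) = y := π.symm_apply_apply y
  simp only [PermGroupColoring.permute, hy] at h
  rw [add_zero]
  exact h.symm
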